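/- Let $F$ be an algebraically closed field of characteristic $0$ and let $G$ be a finitely generated additive abelian group with an alternating bicharacter $\beta:G\times G\to F^\times$ (a $\mathbb Z$-bilinear map with $\beta(g,g)=1$). Put $\mathrm{Rad}(\beta)=\{g\in G:\beta(g,h)=1\ \forall h\in G\}$; $\beta$ is nonsingular if $\mathrm{Rad}(\beta)=0$. A subset $R\subseteq G$ is a skew root system of Jordan type in $(G,\beta)$ if $R$ generates $G$, $R=-R$, and $a+b\in R$ whenever $a,b\in R$ and $\beta(a,b)\neq-1$. It is reduced if $\beta$ is nonsingular; its corresponding reduced skew root system is the image $\overline R$ of $R$ in $(G/\mathrm{Rad}(\beta),\overline\beta)$, where $\overline\beta$ is induced by $\beta$. Two systems are isomorphic if there is a group isomorphism preserving the bicharacters and mapping one set onto the other. The graph of $R$ has vertex set $R$, distinct $a,b$ being joined if and only if $\beta(a,b)\ne-1$; $R$ is called indecomposable as its graph is connected. For a 2-cocycle $\xi:G\times G\to F^\times$ with $\beta(a,b)=\xi(a,b)\xi(b,a)^{-1}$, let $F^\xi G$ be the twisted group algebra with basis $(u_g)_{g\in G}$ and $u_au_b=\xi(a,b)u_{a+b}$.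 For an associative algebra $A$, let $A^+$ be $A$ with the product $x\circ y=\frac12(xy+yx)$. Then $J(R)=\bigoplus_{a\in R}Fu_a$ is a Jordan subalgebra of $(F^\xi G)^+$. Let $k\ge1$, $G=\mathbb Z_2^{2k+1}$ (identified with $\mathbb F_2^{2k+1}$), $h(a)=\sum_{i=1}^k a_{2i-1}a_{2i}+a_{2k+1}^2$, $\beta(a,b)=(-1)^{h(a+b)-h(a)-h(b)}$, and $$R^+=\{a\in G: h(a)=0\}.$$ (1) $R^+$ is a skew root system of Jordan type in $(G,\beta)$. (2) The corresponding reduced skew root system of $R^+$ is isomorphic to the whole group $\mathbb Z_2^{2k}$, as a reduced skew root system of Jordan type in $\mathbb Z_2^{2k}$ with the nonsingular alternating bicharacter $(a,b)\mapsto(-1)^{\sum_{i=1}^k(a_{2i}b_{2i-1}-a_{2i-1}b_{2i})}$. Moreover $R^+$ is nonreduced and indecomposable (its graph is connected), and $|R^+|=2^{2k}$. A 2-cocycle $\xi$ with $\beta(a,b)=\xi(a,b)\xi(b,a)^{-1}$ exists, and for every such $\xi$ the Jordan algebra $J(R^+)$ is isomorphic to $M(2^k,F)^+$. -/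

import Mathlib

/-- An alternating bicharacter on an additive abelian group `G` with values in `Fˣ`:
a `ℤ`-bilinear map `β : G × G → Fˣ` with `β(g, g) = 1`. -/
structure AltBichar (G F : Type*) [AddCommGroup G] [Field F] where
  toFun : G → G → Fˣ
  map_add_left : ∀ a b c, toFun (a + b) c = toFun a c * toFun b c
  map_add_right : ∀ a b c, toFun a (b + c) = toFun a b * toFun a c
  map_self : ∀ a, toFun a a = 1

namespace AltBichar

variable {G F : Type*} [AddCommGroup G] [Field F]

instance : CoeFun (AltBichar G F) (fun _ => G → G → Fˣ) := ⟨AltBichar.toFun⟩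

theorem swap_mul (β : AltBichar G F) (a b : G) : β a b * β b a = 1 := by
  have h := β.map_self (a + b)
  rw [β.map_add_left, β.map_add_right, β.map_add_right, β.map_self, β.map_self] at h
  simpa using h

theorem zero_left (β : AltBichar G F) (a : G) : β 0 a = 1 := by
  have h := β.map_add_left 0 0 a
  rw [add_zero] at h
  exact left_eq_mul.mp h

theorem neg_left (β : AltBichar G F) (a b : G) : β (-a) b = (β a b)⁻¹ := by
  have h := β.map_add_left (-a) a b
  rw [neg_add_cancel, zero_left] at h
  exact eq_inv_of_mul_eq_one_left h.symm

/-- The radical `Rad(β) = {g | β(g, h) = 1 for all h}`. -/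
def rad (β : AltBichar G F) : AddSubgroup G where
  carrier := {g | ∀ h, β g h = 1}
  zero_mem' := fun h => β.zero_left h
  add_mem' := fun {a b} ha hb h => by rw [β.map_add_left, ha h, hb h, one_mul]
  neg_mem' := fun {a} ha h => by rw [β.neg_left, ha h, inv_one]

/-- `β` is nonsingular if its radical is trivial. -/
def IsNonsingular (β : AltBichar G F) : Prop := β.rad = ⊥

theorem congr_left (β : AltBichar G F) {a a' : G} (h : -a + a' ∈ β.rad) (b : G) :
    β a b = β a' b := by
  have h1 := h b
  rw [β.map_add_left, β.neg_left] at h1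
  exact (inv_mul_eq_one.mp h1)

theorem congr_right (β : AltBichar G F) (a : G) {b b' : G} (h : -b + b' ∈ β.rad) :
    β a b = β a b' := by
  rw [eq_inv_of_mul_eq_one_left (β.swap_mul a b), eq_inv_of_mul_eq_one_left (β.swap_mul a b'),
    β.congr_left h a]

/-- The alternating bicharacter induced by `β` on the quotient `G / Rad(β)`. -/
def quotientRad (β : AltBichar G F) : AltBichar (G ⧸ β.rad) F where
  toFun x y := Quotient.liftOn₂' x y (fun a b => β a b) (fun a b a' b' ha hb => by
    rw [β.congr_left (QuotientAddGroup.leftRel_apply.mp ha) b,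
      β.congr_right a' (QuotientAddGroup.leftRel_apply.mp hb)])
  map_add_left := by
    rintro ⟨a⟩ ⟨b⟩ ⟨c⟩
    exact β.map_add_left a b c
  map_add_right := by
    rintro ⟨a⟩ ⟨b⟩ ⟨c⟩
    exact β.map_add_right a b c
  map_self := by
    rintro ⟨a⟩
    exact β.map_self a

theorem quotientRad_mk (β : AltBichar G F) (a b : G) :
    β.quotientRad (a : G ⧸ β.rad) (b : G ⧸ β.rad) = β a b := rfl

/-- The bicharacter `(a, b) ↦ (-1)^{B(a, b)}` of an alternating bilinear form `B` over the field
with two elements. -/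
def ofBilin (F : Type*) [Field F] {V : Type*} [AddCommGroup V] [Module (ZMod 2) V]
    (B : LinearMap.BilinForm (ZMod 2) V) (hB : ∀ v, B v v = 0) : AltBichar V F where
  toFun a b := (-1) ^ (B a b).val
  map_add_left a b c := by
    rw [map_add, LinearMap.add_apply, ← pow_add, ZMod.val_add, ← pow_eq_pow_mod _ (neg_one_sq (R := Fˣ))]
  map_add_right a b c := by
    rw [map_add, ← pow_add, ZMod.val_add, ← pow_eq_pow_mod _ (neg_one_sq (R := Fˣ))]
  map_self a := by simp [hB]

end AltBichar

/-- `R` is a skew root system of Jordan type in the symplectic abelian group `(G, β)`. -/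
structure IsSkewRootSystemJordan {G F : Type*} [AddCommGroup G] [Field F]
    (β : AltBichar G F) (R : Set G) : Prop where
  generates : AddSubgroup.closure R = ⊤
  neg_mem : ∀ a ∈ R, -a ∈ R
  add_mem : ∀ a ∈ R, ∀ b ∈ R, β a b ≠ -1 → a + b ∈ R

/-- Isomorphism `(G₁, β₁, R₁) ≅ (G₂, β₂, R₂)`: a group isomorphism which preserves the alternating
bicharacters and maps `R₁` onto `R₂`. -/
def SkewRootIso {G₁ G₂ F : Type*} [AddCommGroup G₁] [AddCommGroup G₂] [Field F]
    (β₁ : AltBichar G₁ F) (R₁ : Set G₁) (β₂ : AltBichar G₂ F) (R₂ : Set G₂) : Prop :=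
  ∃ φ : G₁ ≃+ G₂, (∀ a b, β₂ (φ a) (φ b) = β₁ a b) ∧ φ '' R₁ = R₂

/-- The graph of a skew root system of Jordan type: the vertex set is `R`, and distinct `a, b` are
joined if and only if `β(a, b) ≠ -1`. -/
def jordanGraph {G F : Type*} [AddCommGroup G] [Field F] (β : AltBichar G F) (R : Set G) :
    SimpleGraph R where
  Adj a b := a ≠ b ∧ β a b ≠ -1
  symm := ⟨fun a b h => ⟨h.1.symm, fun h' => h.2 (by
    rw [eq_inv_of_mul_eq_one_left (β.swap_mul a b), h', inv_neg, inv_one])⟩⟩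
  loopless := ⟨fun _ h => h.1 rfl⟩

/-- A 2-cocycle of the additive abelian group `G` with values in `Fˣ` (trivial action). -/
structure TwoCocycle (G F : Type*) [AddCommGroup G] [Field F] where
  toFun : G → G → Fˣ
  cocycle : ∀ a b c, toFun a b * toFun (a + b) c = toFun b c * toFun a (b + c)

namespace TwoCocycle

variable {G F : Type*} [AddCommGroup G] [Field F]

instance : CoeFun (TwoCocycle G F) (fun _ => G → G → Fˣ) := ⟨TwoCocycle.toFun⟩

/-- `ξ` is a 2-cocycle corresponding to `β`, that is, `β(a, b) = ξ(a, b) ξ(b, a)⁻¹`. -/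
def Corresponds (ξ : TwoCocycle G F) (β : AltBichar G F) : Prop :=
  ∀ a b, β a b = ξ a b * (ξ b a)⁻¹

theorem zero_left (ξ : TwoCocycle G F) (a : G) : ξ 0 a = ξ 0 0 := by
  have h := ξ.cocycle 0 0 a
  rw [add_zero, zero_add] at h
  exact (mul_right_cancel h).symm

theorem zero_right (ξ : TwoCocycle G F) (a : G) : ξ a 0 = ξ 0 0 := by
  have h := ξ.cocycle a 0 0
  rw [add_zero, add_zero] at h
  exact mul_right_cancel h

end TwoCocycle

/-- The twisted group algebra `F^ξ G`: the vector space with basis `u_g`, `g ∈ G`, and the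
multiplication `u_a u_b = ξ(a, b) u_{a+b}`. -/
def TwistedGroupAlgebra {G F : Type*} [AddCommGroup G] [Field F] (_ξ : TwoCocycle G F) : Type _ :=
  G →₀ F

namespace TwistedGroupAlgebra

variable {G F : Type*} [AddCommGroup G] [Field F] (ξ : TwoCocycle G F)

noncomputable instance : AddCommGroup (TwistedGroupAlgebra ξ) :=
  inferInstanceAs (AddCommGroup (G →₀ F))

noncomputable instance : Module F (TwistedGroupAlgebra ξ) :=
  inferInstanceAs (Module F (G →₀ F))

/-- The basis `(u_g)`. -/
noncomputable def u : Module.Basis G F (TwistedGroupAlgebra ξ) := ⟨LinearEquiv.refl F (G →₀ F)⟩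

/-- The bilinear multiplication with `u_a u_b = ξ(a, b) u_{a+b}`. -/
noncomputable def mulBilin :
    TwistedGroupAlgebra ξ →ₗ[F] TwistedGroupAlgebra ξ →ₗ[F] TwistedGroupAlgebra ξ :=
  (u ξ).constr F (fun a => (u ξ).constr F (fun b => (ξ a b : F) • u ξ (a + b)))

theorem mulBilin_u (a b : G) : mulBilin ξ (u ξ a) (u ξ b) = (ξ a b : F) • u ξ (a + b) := by
  simp [mulBilin, Module.Basis.constr_basis]

noncomputable instance : Mul (TwistedGroupAlgebra ξ) := ⟨fun x y => mulBilin ξ x y⟩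

noncomputable instance : One (TwistedGroupAlgebra ξ) := ⟨((ξ 0 0)⁻¹ : Fˣ) • u ξ 0⟩

theorem mul_eq (x y : TwistedGroupAlgebra ξ) : x * y = mulBilin ξ x y := rfl

theorem one_eq : (1 : TwistedGroupAlgebra ξ) = (((ξ 0 0)⁻¹ : Fˣ) : F) • u ξ 0 := rfl

theorem u_mul_u (a b : G) : u ξ a * u ξ b = (ξ a b : F) • u ξ (a + b) := mulBilin_u ξ a b

theorem mulBilin_assoc (x y z : TwistedGroupAlgebra ξ) :
    mulBilin ξ (mulBilin ξ x y) z = mulBilin ξ x (mulBilin ξ y z) := by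
  induction (u ξ).mem_span x using Submodule.span_induction with
  | zero => simp
  | add x x' _ _ hx hx' => simp only [map_add, LinearMap.add_apply, hx, hx']
  | smul c x _ hx => simp only [map_smul, LinearMap.smul_apply, hx]
  | mem x hx =>
    obtain ⟨a, rfl⟩ := hx
    induction (u ξ).mem_span y using Submodule.span_induction with
    | zero => simp
    | add y y' _ _ hy hy' => simp only [map_add, LinearMap.add_apply, hy, hy']
    | smul c y _ hy => simp only [map_smul, LinearMap.smul_apply, hy]
    | mem y hy =>
      obtain ⟨b, rfl⟩ := hy
      induction (u ξ).mem_span z using Submodule.span_induction with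
      | zero => simp
      | add z z' _ _ hz hz' => simp only [map_add, hz, hz']
      | smul c z _ hz => simp only [map_smul, hz]
      | mem z hz =>
        obtain ⟨c, rfl⟩ := hz
        simp only [mulBilin_u, map_smul, LinearMap.smul_apply, smul_smul, add_assoc]
        congr 1
        exact_mod_cast congrArg Units.val (ξ.cocycle a b c)

theorem mulBilin_one_left (x : TwistedGroupAlgebra ξ) : mulBilin ξ 1 x = x := by
  induction (u ξ).mem_span x using Submodule.span_induction with
  | zero => simp
  | add x x' _ _ hx hx' => rw [map_add, hx, hx']
  | smul c x _ hx => rw [map_smul, hx]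
  | mem x hx =>
    obtain ⟨a, rfl⟩ := hx
    rw [one_eq, map_smul, LinearMap.smul_apply, mulBilin_u, smul_smul, ξ.zero_left a, zero_add,
      Units.inv_mul, one_smul]

theorem mulBilin_one_right (x : TwistedGroupAlgebra ξ) : mulBilin ξ x 1 = x := by
  induction (u ξ).mem_span x using Submodule.span_induction with
  | zero => simp
  | add x x' _ _ hx hx' => rw [map_add, LinearMap.add_apply, hx, hx']
  | smul c x _ hx => rw [map_smul, LinearMap.smul_apply, hx]
  | mem x hx =>
    obtain ⟨a, rfl⟩ := hx
    rw [one_eq, map_smul, mulBilin_u, smul_smul, ξ.zero_right a, add_zero, Units.inv_mul, one_smul]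

noncomputable instance : Ring (TwistedGroupAlgebra ξ) :=
  { (inferInstance : AddCommGroup (TwistedGroupAlgebra ξ)),
    (inferInstance : Mul (TwistedGroupAlgebra ξ)),
    (inferInstance : One (TwistedGroupAlgebra ξ)) with
    left_distrib := fun x y z => map_add (mulBilin ξ x) y z
    right_distrib := fun x y z => by
      simp only [mul_eq, map_add, LinearMap.add_apply]
    zero_mul := fun x => by simp only [mul_eq, map_zero, LinearMap.zero_apply]
    mul_zero := fun x => map_zero (mulBilin ξ x)
    mul_assoc := mulBilin_assoc ξ
    one_mul := mulBilin_one_left ξ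
    mul_one := mulBilin_one_right ξ }

noncomputable instance : Algebra F (TwistedGroupAlgebra ξ) :=
  Algebra.ofModule
    (fun r x y => by simp only [mul_eq, map_smul, LinearMap.smul_apply])
    (fun r x y => by simp only [mul_eq, map_smul])

end TwistedGroupAlgebra

/-- In an algebra over a field of characteristic zero, `2` is invertible. -/
noncomputable abbrev algebraInvertibleTwo (F A : Type*) [Field F] [CharZero F] [Ring A] [Algebra F A] :
    Invertible (2 : A) where
  invOf := algebraMap F A 2⁻¹
  invOf_mul_self := by
    rw [← map_ofNat (algebraMap F A) 2, ← map_mul, inv_mul_cancel₀ two_ne_zero, map_one]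
  mul_invOf_self := by
    rw [← map_ofNat (algebraMap F A) 2, ← map_mul, mul_inv_cancel₀ two_ne_zero, map_one]

noncomputable instance {G F : Type*} [AddCommGroup G] [Field F] [CharZero F]
    (ξ : TwoCocycle G F) : Invertible (2 : TwistedGroupAlgebra ξ) :=
  algebraInvertibleTwo F (TwistedGroupAlgebra ξ)

noncomputable instance {F : Type*} [Field F] [CharZero F] (n : ℕ) :
    Invertible (2 : Matrix (Fin n) (Fin n) F) :=
  algebraInvertibleTwo F (Matrix (Fin n) (Fin n) F)

namespace TwistedGroupAlgebra

variable {G F : Type*} [AddCommGroup G] [Field F] [CharZero F] (ξ : TwoCocycle G F)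

theorem sym_smul_mul (c : F) (x y : SymAlg (TwistedGroupAlgebra ξ)) :
    (c • x) * y = c • (x * y) := by
  rw [SymAlg.mul_def, SymAlg.mul_def, SymAlg.unsym_smul, smul_mul_assoc, mul_smul_comm,
    ← smul_add, mul_smul_comm, SymAlg.sym_smul]

/-- `u_a ∘ u_b = ½ (ξ(a, b) + ξ(b, a)) u_{a+b}`. -/
theorem sym_u_mul_sym_u (a b : G) :
    SymAlg.sym (u ξ a) * SymAlg.sym (u ξ b) =
      ((2 : F)⁻¹ * (ξ a b + ξ b a)) • SymAlg.sym (u ξ (a + b)) := by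
  rw [SymAlg.sym_mul_sym, u_mul_u, u_mul_u, add_comm b a, ← add_smul, ← SymAlg.sym_smul, mul_smul,
    Algebra.smul_def (2 : F)⁻¹]
  rfl

end TwistedGroupAlgebra

/-- The Jordan algebra `J(R) = ⨁_{a ∈ R} F u_a` of a skew root system of Jordan type, a subalgebra
of `(F^ξ G)⁺`. Here `SymAlg A` (notation `Aˢʸᵐ`) is the algebra `A⁺`, that is, `A` with the Jordan
product `a ∘ b = (ab + ba) / 2`. -/
noncomputable def jordanAlgebra {G F : Type*} [AddCommGroup G] [Field F] [CharZero F]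
    {β : AltBichar G F} {R : Set G} (hR : IsSkewRootSystemJordan β R)
    (ξ : TwoCocycle G F) (hξ : ξ.Corresponds β) :
    NonUnitalSubalgebra F (SymAlg (TwistedGroupAlgebra ξ)) :=
  (Submodule.span F
    ((fun a => SymAlg.sym (TwistedGroupAlgebra.u ξ a)) '' R)).toNonUnitalSubalgebra (by
  intro x y hx hy
  induction hx using Submodule.span_induction with
  | zero => rw [zero_mul]; exact Submodule.zero_mem _
  | add x x' _ _ hx hx' => rw [add_mul]; exact Submodule.add_mem _ hx hx'
  | smul c x _ hx =>
    rw [TwistedGroupAlgebra.sym_smul_mul]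
    exact Submodule.smul_mem _ c hx
  | mem x hx =>
    obtain ⟨a, ha, rfl⟩ := hx
    induction hy using Submodule.span_induction with
    | zero => rw [mul_zero]; exact Submodule.zero_mem _
    | add y y' _ _ hy hy' => rw [mul_add]; exact Submodule.add_mem _ hy hy'
    | smul c y _ hy =>
      rw [SymAlg.mul_comm, TwistedGroupAlgebra.sym_smul_mul, SymAlg.mul_comm]
      exact Submodule.smul_mem _ c hy
    | mem y hy =>
      obtain ⟨b, hb, rfl⟩ := hy
      rw [TwistedGroupAlgebra.sym_u_mul_sym_u]
      by_cases h : β a b = -1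
      · have h1 : (ξ a b : F) = -(ξ b a : F) := by
          have h2 := hξ a b
          rw [h, eq_mul_inv_iff_mul_eq] at h2
          simpa using (congrArg Units.val h2).symm
        rw [h1, neg_add_cancel, mul_zero, zero_smul]
        exact Submodule.zero_mem _
      · exact Submodule.smul_mem _ _
          (Submodule.subset_span ⟨a + b, hR.add_mem a ha b hb h, rfl⟩))

/-- The quadratic form `h(a) = ∑_{i=1}^k a_{2i-1} a_{2i} + a_{2k+1}²` on `𝔽₂^{2k+1}`; the
coordinates are numbered from `0` here. -/
def oddForm (k : ℕ) : QuadraticForm (ZMod 2) (Fin (2 * k + 1) → ZMod 2) :=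
  ∑ i : Fin k, QuadraticMap.proj ⟨2 * i, by omega⟩ ⟨2 * i + 1, by omega⟩ +
    QuadraticMap.proj (Fin.last (2 * k)) (Fin.last (2 * k))

theorem oddForm_apply (k : ℕ) (a : Fin (2 * k + 1) → ZMod 2) :
    oddForm k a = ∑ i : Fin k, a ⟨2 * i, by omega⟩ * a ⟨2 * i + 1, by omega⟩ +
      a (Fin.last (2 * k)) ^ 2 := by
  simp [oddForm, sq]

/-- The alternating bicharacter `β(a, b) = (-1)^{h(a+b) - h(a) - h(b)}` on `ℤ₂^{2k+1}`. -/
def oddBichar (k : ℕ) (F : Type*) [Field F] : AltBichar (Fin (2 * k + 1) → ZMod 2) F :=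
  AltBichar.ofBilin F (oddForm k).polarBilin (fun v => by
    have h2 : (2 : ZMod 2) = 0 := rfl
    rw [QuadraticMap.polarBilin_apply_apply, QuadraticMap.polar_self, two_smul,
      ← two_mul, h2, zero_mul])

theorem oddBichar_apply (k : ℕ) (F : Type*) [Field F] (a b : Fin (2 * k + 1) → ZMod 2) :
    oddBichar k F a b = (-1) ^ (oddForm k (a + b) - oddForm k a - oddForm k b).val := rfl

/-- `R⁺ = {a | h(a) = 0}`. -/
def oddRootsPlus (k : ℕ) : Set (Fin (2 * k + 1) → ZMod 2) := {a | oddForm k a = 0}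

/-- The alternating bilinear form `∑_{i=1}^k (a_{2i} b_{2i-1} - a_{2i-1} b_{2i})` on `𝔽₂^{2k}`; the
coordinates are numbered from `0` here. -/
def symplecticForm (k : ℕ) : LinearMap.BilinForm (ZMod 2) (Fin (2 * k) → ZMod 2) :=
  LinearMap.mk₂ (ZMod 2)
    (fun a b => ∑ i : Fin k, (a ⟨2 * i + 1, by omega⟩ * b ⟨2 * i, by omega⟩ -
      a ⟨2 * i, by omega⟩ * b ⟨2 * i + 1, by omega⟩))
    (fun a a' b => by
      rw [← Finset.sum_add_distrib]
      exact Finset.sum_congr rfl fun i _ => by simp only [Pi.add_apply]; ring)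
    (fun c a b => by
      rw [Finset.smul_sum]
      exact Finset.sum_congr rfl fun i _ => by simp only [Pi.smul_apply, smul_eq_mul]; ring)
    (fun a b b' => by
      rw [← Finset.sum_add_distrib]
      exact Finset.sum_congr rfl fun i _ => by simp only [Pi.add_apply]; ring)
    (fun c a b => by
      rw [Finset.smul_sum]
      exact Finset.sum_congr rfl fun i _ => by simp only [Pi.smul_apply, smul_eq_mul]; ring)

/-- The symplectic abelian group `ℤ₂^{2k}`, the orthogonal direct sum of `k` copies of
`ℤ₂ × ℤ₂` with `β((i, j), (s, t)) = (-1)^{it - js}`. -/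
def evenBichar (k : ℕ) (F : Type*) [Field F] : AltBichar (Fin (2 * k) → ZMod 2) F :=
  AltBichar.ofBilin F (symplecticForm k) (fun v =>
    show ∑ i : Fin k, (v ⟨2 * i + 1, by omega⟩ * v ⟨2 * i, by omega⟩ -
      v ⟨2 * i, by omega⟩ * v ⟨2 * i + 1, by omega⟩) = 0 from
    Finset.sum_eq_zero fun i _ => by rw [mul_comm, sub_self])

theorem evenBichar_apply (k : ℕ) (F : Type*) [Field F] (a b : Fin (2 * k) → ZMod 2) :
    evenBichar k F a b = (-1) ^ (∑ i : Fin k, (a ⟨2 * i + 1, by omega⟩ * b ⟨2 * i, by omega⟩ -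
      a ⟨2 * i, by omega⟩ * b ⟨2 * i + 1, by omega⟩)).val := rfl

/-! Squaring is additive on `ZMod 2`, so the last coordinate does not enter the polar form of `h`:
`β` is the pullback of the symplectic bicharacter along `dropLast`, and its radical is the line
spanned by the last basis vector. Since `t ^ 2 = t` there, `h(a) = 0` determines the last coordinate
from the others. Thus `R⁺` is the graph of a function on `𝔽₂^{2k}`, `dropLast` maps it bijectively
onto `𝔽₂^{2k}`, and the claims on the reduced system and on `|R⁺|` follow.

For the Jordan algebra, the Weyl matrices (translations times sign characters) form a projective
representation of `G` on functions on `𝔽₂^k`, with an explicit cocycle corresponding to `β`.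
Cocycles with the same `β` are cohomologous (`TwoCocycle.Corresponds.exists_cohomologous`), so
rescaled Weyl matrices represent `F^ξ G` for every `ξ`. This representation is multiplicative, hence
compatible with the Jordan products. By Fourier inversion the matrices indexed by `R⁺` already span
(`span_weylMatrix`), and `|R⁺| = 4^k` is the dimension of the matrix algebra, so the restriction to
`J(R⁺)` is bijective (`jordanAlgebra_equiv_of_span_eq_top`). -/

open scoped Matrix

/-! ### Signs with exponents in `ZMod 2`. -/

section Sign

variable {F : Type*} [Field F]

theorem neg_one_pow_val_add (x y : ZMod 2) :
    (-1 : Fˣ) ^ (x + y).val = (-1) ^ x.val * (-1) ^ y.val := by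
  rw [← pow_add, ZMod.val_add, ← pow_eq_pow_mod _ (neg_one_sq (R := Fˣ))]

theorem neg_one_pow_val_eq_one_iff [CharZero F] (x : ZMod 2) :
    (-1 : Fˣ) ^ x.val = 1 ↔ x = 0 := by
  have h : (1 : ZMod 2).val = 1 := rfl
  obtain rfl | rfl : x = 0 ∨ x = 1 := by revert x; decide
  · simp
  · simp [h, Units.ext_iff, neg_eq_iff_add_eq_zero, one_add_one_eq_two]

theorem neg_one_pow_val_ne_neg_one_iff [CharZero F] (x : ZMod 2) :
    (-1 : Fˣ) ^ x.val ≠ -1 ↔ x = 0 := by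
  have h : (1 : ZMod 2).val = 1 := rfl
  obtain rfl | rfl : x = 0 ∨ x = 1 := by revert x; decide
  · simp [Units.ext_iff, eq_neg_iff_add_eq_zero, one_add_one_eq_two]
  · simp [h]

end Sign

/-! ### Bicharacters, cohomology of cocycles, and Jordan algebras from projective representations.
-/

section General

variable {G F : Type*} [AddCommGroup G] [Field F]

theorem AltBichar.quotientRad_isNonsingular (β : AltBichar G F) :
    β.quotientRad.IsNonsingular := by
  refine (AddSubgroup.eq_bot_iff_forall _).2 ?_
  rintro ⟨a⟩ ha
  exact (QuotientAddGroup.eq_zero_iff a).2 fun b => ha (b : G ⧸ β.rad)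

theorem isSkewRootSystemJordan_univ (β : AltBichar G F) :
    IsSkewRootSystemJordan β Set.univ :=
  ⟨AddSubgroup.closure_univ, fun _ _ => trivial, fun _ _ _ _ _ => trivial⟩

/-- A symmetric 2-cocycle of a finite abelian group with values in the multiplicative group of an
algebraically closed field is a coboundary. -/
theorem TwoCocycle.exists_coboundary_of_symm [IsAlgClosed F] [Finite G] (σ : TwoCocycle G F)
    (hσ : ∀ a b, σ a b = σ b a) :
    ∃ f : G → Fˣ, ∀ a b, f a * f b = σ a b * f (a + b) := by
  -- Symmetry of `σ` makes this finite-dimensional algebra commutative; a residue field embeds in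
  -- `F`, and the values of the resulting character on the basis `u` form the cochain.
  let A := TwistedGroupAlgebra σ
  have hcomm : ∀ x y : A, x * y = y * x := fun x y => by
    have h : TwistedGroupAlgebra.mulBilin σ = (TwistedGroupAlgebra.mulBilin σ).flip :=
      (TwistedGroupAlgebra.u σ).ext fun a => (TwistedGroupAlgebra.u σ).ext fun b => by
        rw [LinearMap.flip_apply, TwistedGroupAlgebra.mulBilin_u, TwistedGroupAlgebra.mulBilin_u,
          hσ, add_comm]
    exact LinearMap.congr_fun₂ h x y
  let _ : CommRing A := { (inferInstance : Ring A) with mul_comm := hcomm }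
  let _ : Algebra F A := inferInstanceAs (Algebra F (TwistedGroupAlgebra σ))
  have : Module.Finite F A := Module.Finite.of_basis (TwistedGroupAlgebra.u σ)
  have : Nontrivial A := ⟨TwistedGroupAlgebra.u σ 0, 0, (TwistedGroupAlgebra.u σ).ne_zero 0⟩
  obtain ⟨m, hm⟩ := Ideal.exists_maximal A
  let _ : Field (A ⧸ m) := Ideal.Quotient.field m
  have : Module.Finite F (A ⧸ m) := inferInstance
  let χ : A →ₐ[F] F :=
    (IsAlgClosed.lift (R := F) (S := A ⧸ m) (M := F)).comp (Ideal.Quotient.mkₐ F m)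
  have hχ : ∀ a b, χ (TwistedGroupAlgebra.u σ a) * χ (TwistedGroupAlgebra.u σ b) =
      σ a b * χ (TwistedGroupAlgebra.u σ (a + b)) := fun a b => by
    have h : (TwistedGroupAlgebra.u σ a : A) * TwistedGroupAlgebra.u σ b =
      (σ a b : F) • TwistedGroupAlgebra.u σ (a + b) := TwistedGroupAlgebra.u_mul_u σ a b
    rw [← map_mul, h, map_smul, smul_eq_mul]
  have h0 : χ (TwistedGroupAlgebra.u σ 0) ≠ 0 := fun h => by
    have h1 : (1 : A) = (((σ 0 0)⁻¹ : Fˣ) : F) • TwistedGroupAlgebra.u σ 0 :=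
      TwistedGroupAlgebra.one_eq σ
    have h2 := congrArg χ h1
    rw [map_one, map_smul, h, smul_zero] at h2
    exact one_ne_zero h2
  -- `u_a u_{-a}` is a nonzero multiple of `u_0`, on which `χ` does not vanish.
  have hne : ∀ a, χ (TwistedGroupAlgebra.u σ a) ≠ 0 := fun a h => by
    have h1 := hχ a (-a)
    rw [h, zero_mul, add_neg_cancel] at h1
    exact mul_ne_zero (σ a (-a)).ne_zero h0 h1.symm
  exact ⟨fun a => Units.mk0 _ (hne a), fun a b => Units.ext (hχ a b)⟩

/-- Over an algebraically closed field, two 2-cocycles of a finite abelian group corresponding to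
the same alternating bicharacter are cohomologous. -/
theorem TwoCocycle.Corresponds.exists_cohomologous [IsAlgClosed F] [Finite G]
    {β : AltBichar G F} {ξ η : TwoCocycle G F} (hξ : ξ.Corresponds β) (hη : η.Corresponds β) :
    ∃ f : G → Fˣ, ∀ a b, η a b * (f a * f b) = ξ a b * f (a + b) := by
  -- The quotient `ξ / η` is symmetric because both cocycles have the same commutator `β`.
  let σ : TwoCocycle G F :=
    { toFun := fun a b => ξ a b * (η a b)⁻¹
      cocycle := fun a b c => by
        rw [mul_mul_mul_comm, ξ.cocycle, ← mul_inv, η.cocycle, mul_inv, mul_mul_mul_comm] }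
  obtain ⟨f, hf⟩ := σ.exists_coboundary_of_symm fun a b => by
    have h := (hξ a b).symm.trans (hη a b)
    rw [mul_inv_eq_iff_eq_mul] at h
    change ξ a b * (η a b)⁻¹ = ξ b a * (η b a)⁻¹
    rw [h, mul_inv_eq_iff_eq_mul]
    simp only [mul_comm, mul_left_comm]
  refine ⟨f, fun a b => ?_⟩
  rw [hf]
  change η a b * (ξ a b * (η a b)⁻¹ * f (a + b)) = _
  rw [mul_comm (ξ a b), mul_assoc, mul_inv_cancel_left]

/-- An algebra-valued map on `G` with `P a * P b = ξ(a, b) P(a + b)` extends to a multiplicative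
linear map on the twisted group algebra. -/
theorem TwistedGroupAlgebra.constr_mul (ξ : TwoCocycle G F) {A : Type*} [Ring A] [Algebra F A]
    (P : G → A) (hP : ∀ a b, P a * P b = (ξ a b : F) • P (a + b)) (x y : TwistedGroupAlgebra ξ) :
    (TwistedGroupAlgebra.u ξ).constr F P (x * y) =
      (TwistedGroupAlgebra.u ξ).constr F P x * (TwistedGroupAlgebra.u ξ).constr F P y := by
  have h : (TwistedGroupAlgebra.mulBilin ξ).compr₂ ((TwistedGroupAlgebra.u ξ).constr F P) =
      (LinearMap.mul F A).compl₁₂ ((TwistedGroupAlgebra.u ξ).constr F P)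
        ((TwistedGroupAlgebra.u ξ).constr F P) :=
    (TwistedGroupAlgebra.u ξ).ext fun a => (TwistedGroupAlgebra.u ξ).ext fun b => by
      simp [TwistedGroupAlgebra.mulBilin_u, Module.Basis.constr_basis, hP]
  exact LinearMap.congr_fun₂ h x y

/-- If the images `P a`, `a ∈ R`, of a projective representation of `G` with cocycle `ξ` span the
algebra `A`, whose dimension is `|R|`, then `J(R) ≅ A⁺`. -/
theorem jordanAlgebra_equiv_of_span_eq_top [CharZero F] {β : AltBichar G F} {R : Set G}
    (hR : IsSkewRootSystemJordan β R) (ξ : TwoCocycle G F) (hξ : ξ.Corresponds β) (hfin : R.Finite)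
    {A : Type*} [Ring A] [Algebra F A] [Invertible (2 : A)] [Module.Finite F A]
    (P : G → A) (hP : ∀ a b, P a * P b = (ξ a b : F) • P (a + b))
    (hspan : Submodule.span F (P '' R) = ⊤) (hdim : Module.finrank F A = R.ncard) :
    ∃ e : jordanAlgebra hR ξ hξ ≃ₗ[F] SymAlg A, ∀ x y, e (x * y) = e x * e y := by
  let π : TwistedGroupAlgebra ξ →ₗ[F] A := (TwistedGroupAlgebra.u ξ).constr F P
  have hπ : ∀ x y, π (x * y) = π x * π y := TwistedGroupAlgebra.constr_mul ξ P hP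
  have hπu : ∀ a, π (TwistedGroupAlgebra.u ξ a) = P a := fun a =>
    Module.Basis.constr_basis _ _ _ _
  -- Whatever the `Invertible` instance, one half is the scalar `2⁻¹`, so linear maps commute with
  -- it.
  have hhalf : ∀ (B : Type _) [Ring B] [Algebra F B] [Invertible (2 : B)],
      ⅟(2 : B) = algebraMap F B 2⁻¹ := fun B _ _ _ => by
    refine invOf_eq_right_inv ?_
    rw [← map_ofNat (algebraMap F B) 2, ← map_mul, mul_inv_cancel₀ two_ne_zero, map_one]
  let L : SymAlg (TwistedGroupAlgebra ξ) →ₗ[F] SymAlg A :=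
    { toFun := fun x => SymAlg.sym (π (SymAlg.unsym x))
      map_add' := fun x y => by simp
      map_smul' := fun c x => by simp }
  have hL : ∀ x y, L (x * y) = L x * L y := fun x y => by
    change SymAlg.sym (π (SymAlg.unsym (x * y))) =
      SymAlg.sym (π (SymAlg.unsym x)) * SymAlg.sym (π (SymAlg.unsym y))
    rw [SymAlg.sym_mul_sym, SymAlg.unsym_mul, ← hπ, ← hπ, ← map_add, hhalf A,
      ← Algebra.smul_def, ← map_smul, Algebra.smul_def]
    rfl
  let J : Submodule F (SymAlg (TwistedGroupAlgebra ξ)) :=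
    Submodule.span F ((fun a => SymAlg.sym (TwistedGroupAlgebra.u ξ a)) '' R)
  have hJfin : Module.Finite F J := Module.Finite.span_of_finite F (hfin.image _)
  -- The upper bound suffices: surjectivity onto `A` supplies the reverse inequality.
  have hJ : Module.finrank F J ≤ R.ncard := by
    have h1 := finrank_span_finset_le_card (R := F)
      ((hfin.image fun a => SymAlg.sym (TwistedGroupAlgebra.u ξ a)).toFinset)
    rw [Set.Finite.coe_toFinset, ← Set.ncard_eq_toFinset_card _ (hfin.image _)] at h1
    exact h1.trans (Set.ncard_image_le hfin)
  let s : A ≃ₗ[F] SymAlg A :=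
    { (SymAlg.sym : A ≃ SymAlg A) with
      map_add' := fun _ _ => rfl
      map_smul' := fun _ _ => rfl }
  have : Module.Finite F (SymAlg A) := Module.Finite.equiv s
  have hsurj : Function.Surjective (L.domRestrict J) := by
    rw [← LinearMap.range_eq_top, LinearMap.range_domRestrict, Submodule.map_span,
      Set.image_image]
    have h2 : (fun a => L (SymAlg.sym (TwistedGroupAlgebra.u ξ a))) '' R =
        (s : A →ₗ[F] SymAlg A) '' (P '' R) := by
      rw [Set.image_image]
      exact Set.image_congr fun a _ => congrArg SymAlg.sym (hπu a)
    rw [h2, ← Submodule.map_span, hspan, Submodule.map_top, LinearMap.range_eq_top]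
    exact s.surjective
  have hdim' : Module.finrank F J = Module.finrank F (SymAlg A) := by
    refine le_antisymm ?_ (LinearMap.finrank_le_finrank_of_surjective hsurj)
    rw [← s.finrank_eq, hdim]
    exact hJ
  have hbij : Function.Bijective (L.domRestrict J) :=
    ⟨(LinearMap.injective_iff_surjective_of_finrank_eq_finrank hdim').2 hsurj, hsurj⟩
  exact ⟨LinearEquiv.ofBijective (L.domRestrict J) hbij, fun x y => hL x y⟩

end General

/-! ### The quadratic form, its zero set `R⁺`, and the reduction modulo the radical. -/

section OddCase

variable {k : ℕ}

/-- Forgetting the last coordinate, `𝔽₂^{n+1} → 𝔽₂^n`. -/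
def dropLast (n : ℕ) : (Fin (n + 1) → ZMod 2) →+ (Fin n → ZMod 2) where
  toFun a j := a j.castSucc
  map_zero' := rfl
  map_add' _ _ := rfl

theorem oddForm_polar (a b : Fin (2 * k + 1) → ZMod 2) :
    oddForm k (a + b) - oddForm k a - oddForm k b =
      symplecticForm k (dropLast _ a) (dropLast _ b) := by
  change _ = ∑ i : Fin k, (a ⟨2 * i + 1, by omega⟩ * b ⟨2 * i, by omega⟩ -
      a ⟨2 * i, by omega⟩ * b ⟨2 * i + 1, by omega⟩)
  have h : ∀ x y : ZMod 2, (x + y) ^ 2 = x ^ 2 + y ^ 2 := by decide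
  simp only [oddForm_apply, Pi.add_apply, h]
  rw [sub_sub, sub_eq_iff_eq_add, add_add_add_comm, ← Finset.sum_add_distrib, ← add_assoc
    (∑ i : Fin k, _) (∑ i : Fin k, _), ← Finset.sum_add_distrib, add_left_inj]
  refine Finset.sum_congr rfl fun i _ => ?_
  generalize a ⟨2 * i, _⟩ = x, a ⟨2 * i + 1, _⟩ = y, b ⟨2 * i, _⟩ = z, b ⟨2 * i + 1, _⟩ = w
  revert x y z w
  decide

theorem oddBichar_eq_evenBichar (F : Type*) [Field F] (a b : Fin (2 * k + 1) → ZMod 2) :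
    oddBichar k F a b = evenBichar k F (dropLast _ a) (dropLast _ b) := by
  rw [oddBichar_apply, oddForm_polar]
  rfl

theorem existsUnique_mem_oddRootsPlus (w : Fin (2 * k) → ZMod 2) :
    ∃! a, a ∈ oddRootsPlus k ∧ dropLast _ a = w := by
  -- Over `ZMod 2`, `x + y ^ 2 = 0` is equivalent to `y = x`.
  have hq : ∀ a : Fin (2 * k + 1) → ZMod 2, dropLast _ a = w → (a ∈ oddRootsPlus k ↔
      a (Fin.last _) = ∑ i : Fin k, w ⟨2 * i, by omega⟩ * w ⟨2 * i + 1, by omega⟩) := by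
    rintro a rfl
    change oddForm k a = 0 ↔
      _ = ∑ i : Fin k, a ⟨2 * i, by omega⟩ * a ⟨2 * i + 1, by omega⟩
    rw [oddForm_apply]
    generalize ∑ i : Fin k, a ⟨2 * i, by omega⟩ * a ⟨2 * i + 1, by omega⟩ = x
    generalize a (Fin.last _) = y
    revert x y
    decide
  have hd : ∀ t : ZMod 2, dropLast _ (Fin.snoc (α := fun _ => ZMod 2) w t) = w := fun t => by
    ext j
    exact Fin.snoc_castSucc (α := fun _ => ZMod 2) t w j
  refine ⟨Fin.snoc (α := fun _ => ZMod 2) w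
    (∑ i : Fin k, w ⟨2 * i, by omega⟩ * w ⟨2 * i + 1, by omega⟩),
    ⟨(hq _ (hd _)).2 (Fin.snoc_last _ _), hd _⟩, ?_⟩
  rintro b ⟨hb, hbw⟩
  ext j
  refine Fin.lastCases ?_ (fun j => ?_) j
  · rw [(hq b hbw).1 hb, Fin.snoc_last]
  · rw [Fin.snoc_castSucc]
    exact congrFun hbw j

theorem bijOn_dropLast_oddRootsPlus :
    Set.BijOn (dropLast (2 * k)) (oddRootsPlus k) Set.univ := by
  refine ⟨fun _ _ => trivial, fun a ha b hb h => ?_, fun w _ => ?_⟩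
  · exact (existsUnique_mem_oddRootsPlus (dropLast _ b)).unique ⟨ha, h⟩ ⟨hb, rfl⟩
  · obtain ⟨a, ha, hw⟩ := (existsUnique_mem_oddRootsPlus w).exists
    exact ⟨a, ha, hw⟩

theorem ncard_oddRootsPlus : (oddRootsPlus k).ncard = 2 ^ (2 * k) := by
  rw [← (bijOn_dropLast_oddRootsPlus (k := k)).injOn.ncard_image,
    bijOn_dropLast_oddRootsPlus.image_eq, Set.ncard_univ]
  simp

theorem evenBichar_isNonsingular (F : Type*) [Field F] [CharZero F] :
    (evenBichar k F).IsNonsingular := by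
  refine (AddSubgroup.eq_bot_iff_forall _).2 fun a ha => ?_
  have hB : ∀ b : Fin (2 * k) → ZMod 2,
      ∑ i : Fin k, (a ⟨2 * i + 1, by omega⟩ * b ⟨2 * i, by omega⟩ -
        a ⟨2 * i, by omega⟩ * b ⟨2 * i + 1, by omega⟩) = 0 := fun b =>
    (neg_one_pow_val_eq_one_iff (F := F) _).1 (ha b)
  ext j
  obtain ⟨j, hj⟩ := j
  obtain ⟨i, rfl | rfl⟩ := Nat.even_or_odd' j
  -- Pairing with the basis vector of the partner coordinate isolates one coordinate of `a`.
  · have h := hB (Pi.single ⟨2 * i + 1, by omega⟩ 1)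
    rw [Finset.sum_eq_single ⟨i, by omega⟩] at h
    · simpa [Pi.single_apply] using h
    · intro l _ hl
      have h1 : (l : ℕ) ≠ i := fun h => hl (Fin.ext h)
      have h2 : 2 * (l : ℕ) ≠ 2 * i + 1 := by omega
      simp [h1, h2]
    · simp
  · have h := hB (Pi.single ⟨2 * i, by omega⟩ 1)
    rw [Finset.sum_eq_single ⟨i, by omega⟩] at h
    · simpa [Pi.single_apply] using h
    · intro l _ hl
      have h1 : (l : ℕ) ≠ i := fun h => hl (Fin.ext h)
      have h2 : 2 * (l : ℕ) + 1 ≠ 2 * i := by omega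
      simp [h1, h2]
    · simp

theorem dropLast_surjective (n : ℕ) : Function.Surjective (dropLast n) := fun w =>
  ⟨Fin.snoc (α := fun _ => ZMod 2) w 0,
    funext fun j => Fin.snoc_castSucc (α := fun _ => ZMod 2) 0 w j⟩

theorem oddBichar_rad (F : Type*) [Field F] [CharZero F] :
    (oddBichar k F).rad = (dropLast (2 * k)).ker := by
  ext a
  constructor
  · intro ha
    have h : dropLast _ a ∈ (evenBichar k F).rad := fun w => by
      obtain ⟨b, rfl⟩ := dropLast_surjective _ w
      rw [← oddBichar_eq_evenBichar]
      exact ha b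
    rw [evenBichar_isNonsingular F] at h
    exact h
  · intro ha b
    rw [oddBichar_eq_evenBichar, AddMonoidHom.mem_ker.1 ha, AltBichar.zero_left]

/-- `R⁺` already reaches every value of the first `2k` coordinates, so only the last basis vector is
missing. It comes from a hyperbolic pair, which is why `k ≥ 1` is needed: for `k = 0` the set is
`{0}`. -/
theorem closure_oddRootsPlus (hk : 1 ≤ k) : AddSubgroup.closure (oddRootsPlus k) = ⊤ := by
  have key : ∀ s t u : ZMod 2, s * t + u ^ 2 = 0 →
      Pi.single ⟨0, by omega⟩ s + Pi.single ⟨1, by omega⟩ t + Pi.single (Fin.last _) u ∈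
        oddRootsPlus k := by
    intro s t u h
    change oddForm k _ = 0
    rw [oddForm_apply, Finset.sum_eq_single ⟨0, by omega⟩]
    · have h0 : (2 * k) ≠ 0 := by omega
      have h1 : (2 * k) ≠ 1 := by omega
      simpa [Pi.single_apply, Fin.ext_iff, h0, h1, h0.symm, h1.symm] using h
    · intro l _ hl
      have h0 : (l : ℕ) ≠ 0 := fun h => hl (Fin.ext h)
      have h1 : 2 * (l : ℕ) ≠ 1 := by omega
      have h2 : 2 * (l : ℕ) ≠ 2 * k := by omega
      have h3 : 2 * (l : ℕ) + 1 ≠ 2 * k := by omega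
      simp [Fin.ext_iff, h0, h1, h2, h3]
    · simp
  have hlast : Pi.single (Fin.last (2 * k)) 1 ∈ AddSubgroup.closure (oddRootsPlus k) := by
    -- With `e₀, e₁` the first hyperbolic pair and `e` the last basis vector, `(e₀ + e₁ + e) - (e₀ +
    -- e₁) = e`, where `e₀ + e₁ + e`, `e₀` and `e₁` are roots.
    have h := sub_mem (AddSubgroup.subset_closure (key 1 1 1 (by decide)))
      (add_mem (AddSubgroup.subset_closure (key 1 0 0 (by decide)))
        (AddSubgroup.subset_closure (key 0 1 0 (by decide))))
    simpa using h
  refine eq_top_iff.2 fun a _ => ?_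
  obtain ⟨b, hb, hba⟩ := (existsUnique_mem_oddRootsPlus (dropLast _ a)).exists
  have hab : a = b + (a (Fin.last _) - b (Fin.last _)).val • Pi.single (Fin.last (2 * k)) 1 := by
    ext j
    refine Fin.lastCases ?_ (fun j => ?_) j
    · simp only [Pi.add_apply, Pi.smul_apply, Pi.single_eq_same, nsmul_one, ZMod.natCast_val,
        ZMod.cast_id', id_eq, add_sub_cancel]
    · have h : b j.castSucc = a j.castSucc := congrFun hba j
      simp [h, (Fin.castSucc_lt_last j).ne]
  rw [hab]
  exact add_mem (AddSubgroup.subset_closure hb) (nsmul_mem hlast _)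

theorem isSkewRootSystemJordan_oddRootsPlus (F : Type*) [Field F] [CharZero F] (hk : 1 ≤ k) :
    IsSkewRootSystemJordan (oddBichar k F) (oddRootsPlus k) where
  generates := closure_oddRootsPlus hk
  neg_mem a ha := by
    have h : -a = a := funext fun j => ZMod.neg_eq_self_mod_two (a j)
    rwa [h]
  add_mem a ha b hb h := by
    -- `β(a, b) ≠ -1` forces the polar form to vanish at `(a, b)`, so `h(a + b) = h(a) + h(b)`.
    rw [oddBichar_apply, neg_one_pow_val_ne_neg_one_iff] at h
    rw [oddRootsPlus, Set.mem_ofPred_eq] at ha hb ⊢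
    rwa [ha, hb, sub_zero, sub_zero] at h

theorem mk_image_oddRootsPlus (F : Type*) [Field F] [CharZero F] :
    (QuotientAddGroup.mk '' oddRootsPlus k :
      Set ((Fin (2 * k + 1) → ZMod 2) ⧸ (oddBichar k F).rad)) = Set.univ := by
  refine Set.eq_univ_of_forall ?_
  rintro ⟨a⟩
  obtain ⟨b, hb, hba⟩ := (existsUnique_mem_oddRootsPlus (dropLast _ a)).exists
  refine ⟨b, hb, QuotientAddGroup.eq.2 ?_⟩
  rw [oddBichar_rad, AddMonoidHom.mem_ker, map_add, map_neg, hba, neg_add_cancel]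

theorem skewRootIso_quotientRad_oddBichar (F : Type*) [Field F] [CharZero F] :
    SkewRootIso (oddBichar k F).quotientRad (QuotientAddGroup.mk '' oddRootsPlus k)
      (evenBichar k F) Set.univ := by
  refine ⟨(QuotientAddGroup.quotientAddEquivOfEq (oddBichar_rad F)).trans
    (QuotientAddGroup.quotientKerEquivOfSurjective _ (dropLast_surjective _)), ?_, ?_⟩
  · rintro ⟨a⟩ ⟨b⟩
    exact (oddBichar_eq_evenBichar F a b).symm
  · rw [mk_image_oddRootsPlus, Set.image_univ, (AddEquiv.surjective _).range_eq]

theorem oddBichar_not_isNonsingular (F : Type*) [Field F] [CharZero F] :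
    ¬ (oddBichar k F).IsNonsingular := by
  intro h
  have h1 : Pi.single (Fin.last (2 * k)) 1 ∈ (oddBichar k F).rad := by
    rw [oddBichar_rad, AddMonoidHom.mem_ker]
    ext j
    exact Pi.single_eq_of_ne (Fin.castSucc_lt_last j).ne _
  rw [AltBichar.IsNonsingular] at h
  rw [h, AddSubgroup.mem_bot, Pi.single_eq_zero_iff] at h1
  exact one_ne_zero h1

/-- The graph of a system containing `0` is connected. -/
theorem jordanGraph_connected_of_zero_mem {G F : Type*} [AddCommGroup G] [Field F] [CharZero F]
    (β : AltBichar G F) {R : Set G} (h0 : 0 ∈ R) : (jordanGraph β R).Connected := by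
  have h : ∀ a : R, (jordanGraph β R).Reachable ⟨0, h0⟩ a := fun a => by
    by_cases ha : (⟨0, h0⟩ : R) = a
    · rw [ha]
    · refine SimpleGraph.Adj.reachable ⟨ha, fun h => ?_⟩
      rw [AltBichar.zero_left] at h
      have h' := congrArg Units.val h
      norm_num at h'
  have : Nonempty R := ⟨⟨0, h0⟩⟩
  exact ⟨fun a b => (h a).symm.trans (h b)⟩

/-! ### The Weyl representation and the Jordan algebra of `R⁺`. -/

/-- The coordinates with odd number in the numbering from `0`. -/
def oddCoords (k : ℕ) : (Fin (2 * k + 1) → ZMod 2) →+ (Fin k → ZMod 2) where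
  toFun a i := a ⟨2 * i + 1, by omega⟩
  map_zero' := rfl
  map_add' _ _ := rfl

/-- The coordinates with even number in the numbering from `0`, except for the last one. -/
def evenCoords (k : ℕ) : (Fin (2 * k + 1) → ZMod 2) →+ (Fin k → ZMod 2) where
  toFun a i := a ⟨2 * i, by omega⟩
  map_zero' := rfl
  map_add' _ _ := rfl

/-- The 2-cocycle `(-1)^{∑ a_{2i} b_{2i-1}}`. -/
def weylCocycle (k : ℕ) (F : Type*) [Field F] : TwoCocycle (Fin (2 * k + 1) → ZMod 2) F where
  toFun a b := (-1) ^ (oddCoords k a ⬝ᵥ evenCoords k b).val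
  cocycle a b c := by
    rw [← neg_one_pow_val_add, ← neg_one_pow_val_add, map_add, map_add, add_dotProduct,
      dotProduct_add]
    congr 2
    ring

theorem weylCocycle_corresponds (F : Type*) [Field F] :
    (weylCocycle k F).Corresponds (oddBichar k F) := by
  intro a b
  rw [eq_mul_inv_iff_mul_eq, oddBichar_eq_evenBichar]
  change (-1 : Fˣ) ^ (∑ i : Fin k, (oddCoords k a i * evenCoords k b i -
    evenCoords k a i * oddCoords k b i)).val * (-1) ^ (oddCoords k b ⬝ᵥ evenCoords k a).val =
    (-1) ^ (oddCoords k a ⬝ᵥ evenCoords k b).val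
  rw [← neg_one_pow_val_add, dotProduct, dotProduct, ← Finset.sum_add_distrib]
  congr 3
  ext i
  ring

/-- The Weyl matrices: `e_v ↦ (-1)^{x · v} e_{v + y}`, where `x`, `y` are the odd and the even
coordinates of `a`. -/
def weylMatrix (k : ℕ) (F : Type*) [Field F] (a : Fin (2 * k + 1) → ZMod 2) :
    Matrix (Fin k → ZMod 2) (Fin k → ZMod 2) F :=
  Matrix.of fun w v => if w = v + evenCoords k a then
    (((-1) ^ (oddCoords k a ⬝ᵥ v).val : Fˣ) : F) else 0

/-- Moving the sign character of `a` past the translation by `evenCoords k b` produces the factor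
`(-1)^{oddCoords k a ⬝ᵥ evenCoords k b}`, which is the cocycle. -/
theorem weylMatrix_mul (F : Type*) [Field F] (a b : Fin (2 * k + 1) → ZMod 2) :
    weylMatrix k F a * weylMatrix k F b =
      (weylCocycle k F a b : F) • weylMatrix k F (a + b) := by
  ext w v
  rw [Matrix.mul_apply, Finset.sum_eq_single (v + evenCoords k b)]
  · simp only [weylMatrix, Matrix.of_apply, Matrix.smul_apply, smul_eq_mul, if_true, map_add,
      add_dotProduct, dotProduct_add]
    rw [add_comm (evenCoords k a), ← add_assoc]
    split_ifs
    · change _ = (((-1) ^ (oddCoords k a ⬝ᵥ evenCoords k b).val : Fˣ) : F) * _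
      simp only [neg_one_pow_val_add, Units.val_mul]
      ring
    · simp
  · intro u _ hu
    simp [weylMatrix, hu]
  · simp

/-- Orthogonality of the characters of `𝔽₂^n`. -/
theorem sum_neg_one_pow_dotProduct (F : Type*) [Field F] [CharZero F] (v : Fin k → ZMod 2) :
    ∑ x : Fin k → ZMod 2, (((-1) ^ (x ⬝ᵥ v).val : Fˣ) : F) = if v = 0 then 2 ^ k else 0 := by
  split_ifs with h
  · simp [h]
  · let ψ : AddChar (Fin k → ZMod 2) F :=
      { toFun := fun x => (((-1) ^ (x ⬝ᵥ v).val : Fˣ) : F)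
        map_zero_eq_one' := by simp
        map_add_eq_mul' := fun x y => by
          rw [add_dotProduct, neg_one_pow_val_add, Units.val_mul] }
    refine AddChar.sum_eq_zero_of_ne_one (ψ := ψ) fun hψ => h ?_
    ext i
    have h1 : ψ (Pi.single i 1) = 1 := by rw [hψ, AddChar.one_apply]
    have h2 : (-1 : Fˣ) ^ (Pi.single i 1 ⬝ᵥ v).val = 1 := Units.ext h1
    rwa [neg_one_pow_val_eq_one_iff, single_one_dotProduct] at h2

theorem exists_mem_oddRootsPlus_coords (x y : Fin k → ZMod 2) :
    ∃ a ∈ oddRootsPlus k, oddCoords k a = x ∧ evenCoords k a = y := by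
  obtain ⟨a, ha, hw⟩ := (existsUnique_mem_oddRootsPlus fun j : Fin (2 * k) =>
    if (j : ℕ) % 2 = 1 then x ⟨j / 2, by omega⟩ else y ⟨j / 2, by omega⟩).exists
  refine ⟨a, ha, funext fun i => ?_, funext fun i => ?_⟩
  · have h : (2 * (i : ℕ) + 1) / 2 = i := by omega
    refine (congrFun hw ⟨2 * i + 1, by omega⟩).trans ?_
    simp [h, Nat.add_mod]
  · refine (congrFun hw ⟨2 * i, by omega⟩).trans ?_
    simp

theorem span_weylMatrix (F : Type*) [Field F] [CharZero F] :
    Submodule.span F (weylMatrix k F '' oddRootsPlus k) = ⊤ := by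
  rw [← (Matrix.stdBasis F (Fin k → ZMod 2) (Fin k → ZMod 2)).span_eq]
  refine le_antisymm (by rw [Module.Basis.span_eq]; exact le_top) (Submodule.span_le.2 ?_)
  rintro _ ⟨⟨w, v⟩, rfl⟩
  rw [Matrix.stdBasis_eq_single]
  -- The roots whose Weyl matrices translate by `w - v`, one for each sign character `x`.
  choose r hr hx hy using fun x => exists_mem_oddRootsPlus_coords (k := k) x (w - v)
  -- Fourier inversion: averaging over `x` with weights `(-1)^{x · v}` keeps only column `v` of the
  -- translation by `w - v`.
  have h : Matrix.single w v (1 : F) = ((2 : F) ^ k)⁻¹ • ∑ x : Fin k → ZMod 2,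
      (((-1) ^ (x ⬝ᵥ v).val : Fˣ) : F) • weylMatrix k F (r x) := by
    ext w' v'
    have hs : ∀ x, ((((-1) ^ (x ⬝ᵥ v).val : Fˣ) : F) • weylMatrix k F (r x)) w' v' =
        if w' = v' + (w - v) then (((-1) ^ (x ⬝ᵥ (v + v')).val : Fˣ) : F) else 0 := fun x => by
      simp only [weylMatrix, Matrix.smul_apply, Matrix.of_apply, hx, hy, smul_eq_mul, mul_ite,
        mul_zero, dotProduct_add, neg_one_pow_val_add, Units.val_mul]
    have hvv : v + v' = 0 ↔ v = v' := by
      rw [add_eq_zero_iff_eq_neg]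
      have h : -v' = v' := funext fun j => ZMod.neg_eq_self_mod_two (v' j)
      rw [h]
    rw [Matrix.smul_apply, Matrix.sum_apply, Finset.sum_congr rfl fun x _ => hs x,
      Matrix.single_apply]
    by_cases hv : v = v'
    · subst hv
      by_cases hw : w = w'
      · subst hw
        simp only [add_sub_cancel, and_self, if_true]
        rw [sum_neg_one_pow_dotProduct, if_pos (hvv.2 rfl), smul_eq_mul,
          inv_mul_cancel₀ (pow_ne_zero _ two_ne_zero)]
      · simp [hw, Ne.symm hw]
    · rw [if_neg fun h => hv h.2]
      split_ifs
      · rw [sum_neg_one_pow_dotProduct, if_neg fun h => hv (hvv.1 h), smul_zero]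
      · simp
  rw [h]
  exact Submodule.smul_mem _ _ (Submodule.sum_mem _ fun x _ =>
    Submodule.smul_mem _ _ (Submodule.subset_span ⟨r x, hr x, rfl⟩))

theorem jordanAlgebra_oddRootsPlus_equiv (F : Type*) [Field F] [IsAlgClosed F] [CharZero F]
    (hR : IsSkewRootSystemJordan (oddBichar k F) (oddRootsPlus k))
    (ξ : TwoCocycle (Fin (2 * k + 1) → ZMod 2) F) (hξ : ξ.Corresponds (oddBichar k F)) :
    ∃ e : jordanAlgebra hR ξ hξ ≃ₗ[F] SymAlg (Matrix (Fin (2 ^ k)) (Fin (2 ^ k)) F),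
      ∀ x y, e (x * y) = e x * e y := by
  -- Rescaling the Weyl matrices by `f` turns their cocycle into `ξ`; since `f` takes unit values,
  -- the span is unchanged.
  obtain ⟨f, hf⟩ := hξ.exists_cohomologous (weylCocycle_corresponds F)
  let ι : (Fin k → ZMod 2) ≃ Fin (2 ^ k) := Fintype.equivFinOfCardEq (by simp)
  let ρ := Matrix.reindexAlgEquiv F F ι
  refine jordanAlgebra_equiv_of_span_eq_top hR ξ hξ (Set.toFinite _)
    (fun a => ρ ((f a : F) • weylMatrix k F a)) (fun a b => ?_) ?_ ?_
  · rw [← map_mul, ← map_smul, smul_mul_smul_comm, weylMatrix_mul, smul_smul, smul_smul]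
    congr 2
    rw [mul_comm]
    exact_mod_cast congrArg Units.val (hf a b)
  · rw [eq_top_iff]
    have h := congrArg (Submodule.map ρ.toLinearMap) (span_weylMatrix (k := k) F)
    rw [Submodule.map_top, LinearMap.range_eq_top.2 ρ.surjective, Submodule.map_span] at h
    rw [← h, Submodule.span_le]
    rintro _ ⟨_, ⟨a, ha, rfl⟩, rfl⟩
    have h1 : ρ.toLinearMap (weylMatrix k F a) =
        ((f a)⁻¹ : Fˣ).val • ρ ((f a : F) • weylMatrix k F a) := by
      rw [← map_smul, smul_smul, Units.inv_mul, one_smul]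
      rfl
    rw [h1]
    exact Submodule.smul_mem _ _ (Submodule.subset_span ⟨a, ha, rfl⟩)
  · rw [ncard_oddRootsPlus, Module.finrank_matrix]
    simp [← pow_add, two_mul]

end OddCase

theorem mainTheorem8 (F : Type*) [Field F] [IsAlgClosed F] [CharZero F] (k : ℕ) (hk : 1 ≤ k) :
    ∃ hR : IsSkewRootSystemJordan (oddBichar k F) (oddRootsPlus k),
      -- the corresponding reduced skew root system is `ℤ₂^{2k}`
      ((evenBichar k F).IsNonsingular ∧
        IsSkewRootSystemJordan (evenBichar k F) Set.univ ∧
        (oddBichar k F).quotientRad.IsNonsingular ∧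
        IsSkewRootSystemJordan (oddBichar k F).quotientRad
          (QuotientAddGroup.mk '' oddRootsPlus k) ∧
        SkewRootIso (oddBichar k F).quotientRad (QuotientAddGroup.mk '' oddRootsPlus k)
          (evenBichar k F) Set.univ) ∧
      -- nonreduced and indecomposable
      ¬ (oddBichar k F).IsNonsingular ∧
      (jordanGraph (oddBichar k F) (oddRootsPlus k)).Connected ∧
      (oddRootsPlus k).ncard = 2 ^ (2 * k) ∧
      -- the Jordan algebra, for any choice of the 2-cocycle
      (∃ ξ : TwoCocycle (Fin (2 * k + 1) → ZMod 2) F, ξ.Corresponds (oddBichar k F)) ∧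
      ∀ (ξ : TwoCocycle (Fin (2 * k + 1) → ZMod 2) F) (hξ : ξ.Corresponds (oddBichar k F)),
        ∃ e : jordanAlgebra hR ξ hξ ≃ₗ[F] SymAlg (Matrix (Fin (2 ^ k)) (Fin (2 ^ k)) F),
          ∀ x y, e (x * y) = e x * e y := by
  refine ⟨isSkewRootSystemJordan_oddRootsPlus F hk,
    ⟨evenBichar_isNonsingular F, isSkewRootSystemJordan_univ _,
      AltBichar.quotientRad_isNonsingular _, ?_, skewRootIso_quotientRad_oddBichar F⟩,
    oddBichar_not_isNonsingular F,
    jordanGraph_connected_of_zero_mem _ (map_zero (oddForm k)), ncard_oddRootsPlus,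
    ⟨weylCocycle k F, weylCocycle_corresponds F⟩,
    jordanAlgebra_oddRootsPlus_equiv F _⟩
  rw [mk_image_oddRootsPlus]
  exact isSkewRootSystemJordan_univ _
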